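/- **Setting.** Let $\mathbb P$ be a probability measure on $\mathbb R^m$, $\alpha\in(0,1]$, and $C:\mathbb R^n\times\mathbb R^m\to\mathbb R^n$ measurable. For a real random variable $Z$ put $\operatorname{CVaR}_\alpha[Z]=\inf_{\eta\in\mathbb R}\{\eta+\alpha^{-1}\mathbb E[Z-\eta]^+\}$, and let $F:\mathbb R^n\to\mathbb R^n$ be given by $F_i(h)=\operatorname{CVaR}_\alpha[C_i(h,\xi)]$, $\xi\sim\mathbb P$. Assume that $F$ is continuous and strictly monotone, i.e. $(F(x)-F(y))^\top(x-y)>0$ for $x\ne y$. Let $A\in\mathbb R^{l\times n}$, $b\in\mathbb R^l$, let $q^1,\dots,q^s:\mathbb R^n\to\mathbb R$ be convex and continuously differentiable, and put $\mathcal H_{\rm aff}=\{h: Ah=b\}$, $\mathcal H_{\rm ineq}=\{h: q^i(h)\le 0\ \forall i\}$, $\mathcal H=\mathcal H_{\rm aff}\cap\mathcal H_{\rm ineq}$. Assume that $\mathcal H$ is nonempty and compact, and let $h^*$ be the solution of the variational inequality: $h^*\in\mathcal H$ and $(h-h^*)^\top F(h^*)\ge 0$ for all $h\in\mathcal H$.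 **Algorithm.** Let $L$ be the orthogonal projection onto $\ker A$ and $\Pi_{\mathcal H_{\rm ineq}}$ the Euclidean projection onto $\mathcal H_{\rm ineq}$. Given $h^0\in\mathcal H_{\rm aff}$, $c>0$, step-sizes $\gamma^k>0$ with $\sum_k\gamma^k=\infty$ and $\sum_k(\gamma^k)^2<\infty$, and sample sizes $N_k\in\mathbb N$, let $$h^{k+1}=h^k-\gamma^kL\Big(F(h^k)+c\big(h^k-\Pi_{\mathcal H_{\rm ineq}}(h^k)\big)+\widehat\beta^{N_k}\Big),\qquad \widehat\beta^{N_k}=\widehat F^{N_k}(h^k)-F(h^k),$$ where $\widehat F^{N_k}_i(h)=\inf_{t\in\mathbb R}\{t+(N_k\alpha)^{-1}\sum_{j=1}^{N_k}[C_i(h,\xi^k_j)-t]^+\}$ and the samples $\xi^k_j$ ($k\ge 0$, $1\le j\le N_k$) are i.i.d. with law $\mathbb P$. **Claim.** The iterates satisfy $h^k\in\mathcal H_{\rm aff}$ for all $k$. Moreover, for all $\epsilon>0$ and $B_{\rm traj}$ there is $c_\epsilon=c_\epsilon(B_{\rm traj})>0$, and for every $B_{\rm err}$ there is $N_\epsilon=N_\epsilon(B_{\rm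 traj},B_{\rm err})\in\mathbb N$, such that every run of the algorithm with $c\ge c_\epsilon$ and $N_k\ge N_\epsilon$ for all $k$ for which, with probability one, $\|h^k\|\le B_{\rm traj}$ and $\|\widehat\beta^{N_k}\|\le B_{\rm err}$ for all $k$, satisfies, with probability one, $$\limsup_{k\to\infty}\|h^k-h^*\|\le\epsilon .$$ The thresholds $c_\epsilon,N_\epsilon$ do not depend on the step-sizes, the initial point, the sequence $(N_k)$ or $c$. -/

import Mathlib

open MeasureTheory ProbabilityTheory Filter

noncomputable section

namespace CVaRVI

/-- `ℝⁿ` with its Euclidean norm. -/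
abbrev E (n : ℕ) : Type := EuclideanSpace ℝ (Fin n)

/-- Conditional value-at-risk at level `α` of `Z` under `P`:
`inf_η { η + α⁻¹ E[Z - η]⁺ }`. -/
def CVaR {X : Type*} [MeasurableSpace X] (P : Measure X) (α : ℝ) (Z : X → ℝ) : ℝ :=
  ⨅ η : ℝ, (η + α⁻¹ * ∫ x, max (Z x - η) 0 ∂P)

/-- Empirical estimate of the conditional value-at-risk from the `N` sample values `z`:
`inf_η { η + (N α)⁻¹ ∑ⱼ [zⱼ - η]⁺ }`. -/
def empCVaR (α : ℝ) {N : ℕ} (z : Fin N → ℝ) : ℝ :=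
  ⨅ η : ℝ, (η + ((N : ℝ) * α)⁻¹ * ∑ j, max (z j - η) 0)

/-- The map `F`, with components `F_i(h) = CVaR_α[C_i(h, ξ)]`, `ξ ∼ P`. -/
def cvarMap {n m : ℕ} (P : Measure (E m)) (α : ℝ) (C : E n → E m → E n) (h : E n) : E n :=
  WithLp.toLp 2 fun i => CVaR P α fun ξ => C h ξ i

/-- The estimator of `F(h)` built from the samples `x₁, …, x_N`; all components use the same
samples. -/
def empMap {n m : ℕ} (α : ℝ) (C : E n → E m → E n) {N : ℕ} (x : Fin N → E m) (h : E n) : E n :=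
  WithLp.toLp 2 fun i => empCVaR α fun j => C h (x j) i

/-- The estimation error at `h`: estimator minus `F(h)`. -/
def estError {n m : ℕ} (P : Measure (E m)) (α : ℝ) (C : E n → E m → E n) {N : ℕ}
    (x : Fin N → E m) (h : E n) : E n :=
  empMap α C x h - cvarMap P α C h

/-- The affine set `{h | A h = b}`. -/
def affSet {n l : ℕ} (A : Matrix (Fin l) (Fin n) ℝ) (b : E l) : Set (E n) :=
  {h | Matrix.toEuclideanLin A h = b}

/-- The set `{h | qⁱ(h) ≤ 0 for all i}`. -/
def ineqSet {n s : ℕ} (q : Fin s → E n → ℝ) : Set (E n) :=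
  {h | ∀ i, q i h ≤ 0}

/-- The feasible set `{h | A h = b, qⁱ(h) ≤ 0 for all i}`. -/
def feasSet {n l s : ℕ} (A : Matrix (Fin l) (Fin n) ℝ) (b : E l) (q : Fin s → E n → ℝ) :
    Set (E n) :=
  affSet A b ∩ ineqSet q

/-- The solution set of the variational inequality `VI(H, F)`. -/
def SOL {n : ℕ} (H : Set (E n)) (F : E n → E n) : Set (E n) :=
  {x | x ∈ H ∧ ∀ h ∈ H, 0 ≤ inner ℝ (h - x) (F x)}

/-- Strict monotonicity of a map on `ℝⁿ`. -/
def StrictlyMonotone {n : ℕ} (F : E n → E n) : Prop :=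
  ∀ x y, x ≠ y → 0 < inner ℝ (F x - F y) (x - y)

/-- The Euclidean projection `argmin_{y ∈ S} ‖x - y‖`
(the minimizer exists and is unique when `S` is nonempty, closed and convex). -/
def proj {n : ℕ} (S : Set (E n)) (x : E n) : E n :=
  Classical.epsilon fun y => y ∈ S ∧ ∀ z ∈ S, ‖x - y‖ ≤ ‖x - z‖

/-- The matrix `L`: orthogonal projection of `ℝⁿ` onto `ker A`. -/
def kerProj {n l : ℕ} (A : Matrix (Fin l) (Fin n) ℝ) : E n →L[ℝ] E n :=
  (LinearMap.ker (Matrix.toEuclideanLin A)).starProjection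

/-- The iterates of the subspace-constrained algorithm
`h^{k+1} = h^k - γ^k L (F(h^k) + c (h^k - Π_{ineq}(h^k)) + β^k)`, where `β^k` is the error of the
estimator built from the `N k` samples `x k` drawn at iteration `k`. -/
def subspaceIter {n m l s : ℕ} (P : Measure (E m)) (α : ℝ) (C : E n → E m → E n)
    (A : Matrix (Fin l) (Fin n) ℝ) (q : Fin s → E n → ℝ) (γ : ℕ → ℝ) (c : ℝ) (N : ℕ → ℕ)
    (x : (k : ℕ) → Fin (N k) → E m) (h0 : E n) : ℕ → E n
  | 0 => h0
  | k + 1 =>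
    subspaceIter P α C A q γ c N x h0 k
      - γ k • kerProj A
          (cvarMap P α C (subspaceIter P α C A q γ c N x h0 k)
            + c • (subspaceIter P α C A q γ c N x h0 k
                - proj (ineqSet q) (subspaceIter P α C A q γ c N x h0 k))
            + estError P α C (x k) (subspaceIter P α C A q γ c N x h0 k))

/-- The step-sizes are positive with `∑ γ^k = ∞` and `∑ (γ^k)² < ∞`. -/
def IsStepSize (γ : ℕ → ℝ) : Prop :=
  (∀ k, 0 < γ k) ∧ ¬ Summable γ ∧ Summable fun k => γ k ^ 2

/-- The samples `ξ k j`, `j < N k`, over all iterations `k`, are i.i.d. with law `P`. -/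
def IIDSamples {Ω : Type*} [MeasurableSpace Ω] (μ : Measure Ω) {m : ℕ} (P : Measure (E m))
    (N : ℕ → ℕ) (ξ : (k : ℕ) → Fin (N k) → Ω → E m) : Prop :=
  (∀ k j, Measurable (ξ k j)) ∧ (∀ k j, μ.map (ξ k j) = P) ∧
    iIndepFun (fun p : (k : ℕ) × Fin (N k) => ξ p.1 p.2) μ

end CVaRVI

end

/-! The Lyapunov function is `V k = ‖h k - hstar‖ ^ 2`. Both points lie in the affine set and the
projection onto `ker A` is self-adjoint, so it drops out of the cross term: up to an `O(γ k ^ 2)`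
term, `V` changes by `-2 γ k` times the inner product of `h k - hstar` with the penalized field plus
the estimation error.

The field contributes at least some `δ > 0` whenever `‖h k - hstar‖ ≥ ε`, once the penalty is large
(`exists_penalty_inner_ge`): strict monotonicity handles feasible points, the penalty infeasible
ones, and compactness makes this uniform.

The error splits into its mean over the fresh batch, with the current iterate frozen, and a
martingale difference. `C` is only measurable, so uniform consistency has to come from the bound on
the error itself: it forces each `C_i(h, ξ)` to lie almost surely within `Berr` of `F_i(h)`, and a
Chebyshev bound on a finite net of thresholds then needs a sample size depending only on `α`, `Berr`
and the tolerance. This brings the mean below `δ / 2`. The martingale part has convergent weighted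
sums because `∑ γ ^ 2 < ∞` (`ae_exists_tendsto_sum_centred`).

What remains is a deterministic descent recursion with a convergent perturbation
(`eventually_le_of_descent`). -/

namespace CVaRVI

open scoped Topology

/-! ### Euclidean projection onto closed convex sets -/

section Projection

variable {n : ℕ} {S : Set (E n)}

lemma proj_spec (hne : S.Nonempty) (hcl : IsClosed S) (x : E n) :
    proj S x ∈ S ∧ ∀ z ∈ S, ‖x - proj S x‖ ≤ ‖x - z‖ := by
  obtain ⟨y, hy, hd⟩ := hcl.exists_infDist_eq_dist hne x
  refine Classical.epsilon_spec (p := fun y => y ∈ S ∧ ∀ z ∈ S, ‖x - y‖ ≤ ‖x - z‖)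
    ⟨y, hy, fun z hz => ?_⟩
  rw [← dist_eq_norm, ← dist_eq_norm, ← hd]
  exact Metric.infDist_le_dist_of_mem hz

lemma inner_sub_proj_le_zero (hcl : IsClosed S) (hconv : Convex ℝ S) (x : E n) {z : E n}
    (hz : z ∈ S) : inner ℝ (x - proj S x) (z - proj S x) ≤ 0 := by
  obtain ⟨hmem, hmin⟩ := proj_spec ⟨z, hz⟩ hcl x
  refine (norm_eq_iInf_iff_real_inner_le_zero hconv hmem).1 ?_ z hz
  have : Nonempty S := ⟨⟨z, hz⟩⟩
  refine le_antisymm (le_ciInf fun w => hmin w w.2) ?_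
  exact ciInf_le ⟨0, by rintro _ ⟨w, rfl⟩; exact norm_nonneg _⟩ (⟨_, hmem⟩ : S)

/-- Adding the variational inequalities of the two projections gives `‖p - r‖ ^ 2 ≤ ⟪x - y, p - r⟫`;
Cauchy–Schwarz does the rest. -/
lemma norm_proj_sub_proj_le (hne : S.Nonempty) (hcl : IsClosed S) (hconv : Convex ℝ S)
    (x y : E n) : ‖proj S x - proj S y‖ ≤ ‖x - y‖ := by
  have hx := inner_sub_proj_le_zero hcl hconv x (proj_spec hne hcl y).1
  have hy := inner_sub_proj_le_zero hcl hconv y (proj_spec hne hcl x).1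
  set p := proj S x
  set r := proj S y
  have h1 : inner ℝ (x - p) (r - p) + inner ℝ (y - r) (p - r)
      = ‖p - r‖ ^ 2 - inner ℝ (x - y) (p - r) := by
    rw [← real_inner_self_eq_norm_sq]
    have e1 : r - p = -(p - r) := by abel
    have e2 : y - r = (x - p) - (x - y) + (p - r) := by abel
    rw [e1, inner_neg_right, e2, inner_add_left, inner_sub_left (x - p)]
    ring
  have h2 := real_inner_le_norm (x - y) (p - r)
  by_contra! h3
  nlinarith [norm_nonneg (x - y), norm_nonneg (p - r)]

lemma continuous_proj (hne : S.Nonempty) (hcl : IsClosed S) (hconv : Convex ℝ S) :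
    Continuous (proj S) := by
  refine (LipschitzWith.of_dist_le_mul (K := 1) fun x y => ?_).continuous
  simpa [dist_eq_norm] using norm_proj_sub_proj_le hne hcl hconv x y

/-- Used with `z = hstar`: the penalty always pulls towards the solution, at least as strongly as
the squared infeasibility. -/
lemma sq_norm_sub_proj_le_inner (hcl : IsClosed S) (hconv : Convex ℝ S) (x : E n) {z : E n}
    (hz : z ∈ S) : ‖x - proj S x‖ ^ 2 ≤ inner ℝ (x - z) (x - proj S x) := by
  have h := inner_sub_proj_le_zero hcl hconv x hz
  have e : x - z = (x - proj S x) - (z - proj S x) := by abel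
  rw [e, inner_sub_left, real_inner_self_eq_norm_sq, real_inner_comm]
  linarith

end Projection

/-! ### The feasible set and the effect of the penalty -/

section FeasibleSet

variable {n l s : ℕ} {A : Matrix (Fin l) (Fin n) ℝ} {b : E l} {q : Fin s → E n → ℝ}

lemma isClosed_affSet : IsClosed (affSet A b) :=
  isClosed_eq (LinearMap.continuous_of_finiteDimensional _) continuous_const

lemma isClosed_ineqSet (hq : ∀ i, Continuous (q i)) : IsClosed (ineqSet q) := by
  simp only [ineqSet, Set.ofPred_forall]
  exact isClosed_iInter fun i => isClosed_le (hq i) continuous_const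

lemma convex_ineqSet (hq : ∀ i, ConvexOn ℝ Set.univ (q i)) : Convex ℝ (ineqSet q) := by
  simp only [ineqSet, Set.ofPred_forall]
  exact convex_iInter fun i => by simpa using (hq i).convex_le 0

lemma sub_mem_ker {x y : E n} (hx : x ∈ affSet A b) (hy : y ∈ affSet A b) :
    x - y ∈ LinearMap.ker (Matrix.toEuclideanLin A) := by
  have hx' : Matrix.toEuclideanLin A x = b := hx
  have hy' : Matrix.toEuclideanLin A y = b := hy
  rw [LinearMap.mem_ker, map_sub, hx', hy', sub_self]

lemma sub_smul_kerProj_mem_affSet {x : E n} (hx : x ∈ affSet A b) (t : ℝ) (v : E n) :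
    x - t • kerProj A v ∈ affSet A b := by
  have hx' : Matrix.toEuclideanLin A x = b := hx
  have h : kerProj A v ∈ LinearMap.ker (Matrix.toEuclideanLin A) :=
    Submodule.starProjection_apply_mem _ v
  rw [LinearMap.mem_ker] at h
  change Matrix.toEuclideanLin A (x - t • kerProj A v) = b
  rw [map_sub, map_smul, h, hx', smul_zero, sub_zero]

lemma inner_kerProj {x y : E n} (hx : x ∈ affSet A b) (hy : y ∈ affSet A b) (v : E n) :
    inner ℝ (x - y) (kerProj A v) = inner ℝ (x - y) v := by
  rw [kerProj, ← Submodule.inner_starProjection_left_eq_right,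
    Submodule.starProjection_eq_self_iff.2 (sub_mem_ker hx hy)]

lemma norm_kerProj_le (v : E n) : ‖kerProj A v‖ ≤ ‖v‖ :=
  Submodule.norm_starProjection_apply_le _ v

/-- For a large penalty the penalized field points away from the solution of the variational
inequality, uniformly on bounded parts of the affine set away from the solution. -/
lemma exists_penalty_inner_ge {F : E n → E n} (hF : Continuous F) (hmono : StrictlyMonotone F)
    (hcl : IsClosed (ineqSet q)) (hconv : Convex ℝ (ineqSet q)) {hstar : E n}
    (hsol : hstar ∈ SOL (feasSet A b q) F) {ε : ℝ} (hε : 0 < ε) (R : ℝ) :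
    ∃ c₀ : ℝ, 0 < c₀ ∧ ∃ δ : ℝ, 0 < δ ∧ ∀ c, c₀ ≤ c → ∀ h ∈ affSet A b, ‖h‖ ≤ R →
      ε ≤ ‖h - hstar‖ →
        δ ≤ inner ℝ (h - hstar) (F h + c • (h - proj (ineqSet q) h)) := by
  have hne : (ineqSet q).Nonempty := ⟨hstar, hsol.1.2⟩
  have hpc := continuous_proj hne hcl hconv
  let g : E n → ℝ := fun h => inner ℝ (h - hstar) (F h)
  let d : E n → ℝ := fun h => ‖h - proj (ineqSet q) h‖ ^ 2
  have hg : Continuous g := (continuous_id.sub continuous_const).inner hF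
  have hd : Continuous d := ((continuous_id.sub hpc).norm).pow 2
  have hd0 : ∀ h, 0 ≤ d h := fun h => sq_nonneg _
  let K : Set (E n) := (affSet A b ∩ {h | ε ≤ ‖h - hstar‖}) ∩ Metric.closedBall 0 R
  have hK : IsCompact K := (isCompact_closedBall (0 : E n) R).inter_left
    (isClosed_affSet.inter
      (isClosed_le continuous_const (continuous_id.sub continuous_const).norm))
  -- One index `j` serves both as penalty weight and, through `1 / (j + 1)`, as margin. The sets
  -- increase with `j`, so by compactness a single one covers `K`.
  let U : ℕ → Set (E n) := fun j => {h | 1 / ((j : ℝ) + 1) < g h + j * d h}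
  have hUo : ∀ j, IsOpen (U j) := fun j =>
    isOpen_lt continuous_const (hg.add (continuous_const.mul hd))
  have hUmono : Monotone U := by
    intro i j hij h (hh : 1 / ((i : ℝ) + 1) < g h + i * d h)
    change 1 / ((j : ℝ) + 1) < g h + j * d h
    have hij' : (i : ℝ) ≤ j := by exact_mod_cast hij
    calc 1 / ((j : ℝ) + 1) ≤ 1 / ((i : ℝ) + 1) := by gcongr
      _ < g h + i * d h := hh
      _ ≤ g h + j * d h := by gcongr
  have hcov : K ⊆ ⋃ j, U j := by
    rintro h ⟨⟨hA, hdist⟩, -⟩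
    rw [Set.mem_iUnion]
    -- Feasible `h`: strict monotonicity and the variational inequality give `g h > 0`. Infeasible
    -- `h`: `d h > 0`, so a large weight wins.
    rcases (hd0 h).eq_or_lt with h0 | hpos
    · have hz : h = proj (ineqSet q) h := by
        have : ‖h - proj (ineqSet q) h‖ = 0 := pow_eq_zero_iff two_ne_zero |>.1 h0.symm
        exact sub_eq_zero.1 (norm_eq_zero.1 this)
      have hin : h ∈ ineqSet q := by rw [hz]; exact (proj_spec hne hcl h).1
      have hneq : h ≠ hstar := by
        rintro rfl
        simp only [Set.mem_ofPred_eq, sub_self, norm_zero] at hdist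
        linarith
      have hgpos : 0 < g h := by
        have h1 := hmono h hstar hneq
        have h2 := hsol.2 h ⟨hA, hin⟩
        rw [real_inner_comm, inner_sub_right] at h1
        change 0 < inner ℝ (h - hstar) (F h)
        linarith
      obtain ⟨j, hj⟩ := exists_nat_one_div_lt hgpos
      exact ⟨j, by change 1 / ((j : ℝ) + 1) < g h + j * d h; rw [← h0]; simpa using hj⟩
    · obtain ⟨j, hj⟩ := exists_nat_gt ((1 - g h) / d h)
      refine ⟨j, ?_⟩
      rw [div_lt_iff₀ hpos] at hj
      have : 1 / ((j : ℝ) + 1) ≤ 1 := by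
        rw [div_le_one (by positivity)]; linarith [j.cast_nonneg (α := ℝ)]
      change 1 / ((j : ℝ) + 1) < g h + j * d h
      linarith
  obtain ⟨j, hj⟩ := hK.elim_directed_cover U hUo hcov hUmono.directed_le
  refine ⟨j + 1, by positivity, 1 / ((j : ℝ) + 1), by positivity, fun c hc h hA hR hdist => ?_⟩
  have hmem : h ∈ K := ⟨⟨hA, hdist⟩, by simpa using hR⟩
  have h1 : 1 / ((j : ℝ) + 1) < g h + j * d h := hj hmem
  have h2 := sq_norm_sub_proj_le_inner hcl hconv h hsol.1.2
  rw [inner_add_right, inner_smul_right]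
  have hc0 : 0 ≤ c := le_trans (by positivity) hc
  have h3 : j * d h ≤ c * inner ℝ (h - hstar) (h - proj (ineqSet q) h) :=
    mul_le_mul (by linarith) h2 (hd0 h) hc0
  linarith

end FeasibleSet

/-! ### Deterministic descent with a convergent perturbation -/

/-- A perturbed descent recursion eventually enters every neighbourhood of the sublevel set
outside of which it descends. -/
lemma eventually_le_of_descent {V a γ S : ℕ → ℝ} {r δ M L : ℝ} (hV : ∀ k, 0 ≤ V k)
    (hγ : ∀ k, 0 < γ k) (hγ0 : Tendsto γ atTop (𝓝 0)) (hγs : ¬ Summable γ)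
    (hS : Tendsto S atTop (𝓝 L))
    (hstep : ∀ k, V (k + 1) ≤ V k - γ k * a k + (S (k + 1) - S k))
    (hM : ∀ k, -M ≤ a k) (hδ : 0 < δ) (ha : ∀ k, r ≤ V k → δ ≤ a k) {η : ℝ} (hη : 0 < η) :
    ∀ᶠ k in atTop, V k ≤ r + η := by
  have h1 : ∀ᶠ k in atTop, |S k - L| < η / 4 := by
    have := Metric.tendsto_nhds.1 hS (η / 4) (by linarith)
    simpa [Real.dist_eq] using this
  have h2 : ∀ᶠ k in atTop, γ k * M < η / 2 := by
    have : Tendsto (fun k => γ k * M) atTop (𝓝 (0 * M)) := hγ0.mul_const M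
    rw [zero_mul] at this
    exact this.eventually_lt_const (by linarith)
  obtain ⟨K, hK⟩ := eventually_atTop.1 (h1.and h2)
  -- Staying above `r` forever would cost `δ * ∑ γ`, which is infinite, against a bounded budget.
  obtain ⟨k₀, hk₀, hVk₀⟩ : ∃ k₀, K ≤ k₀ ∧ V k₀ < r := by
    by_contra! hcon
    have hbound : ∀ i, V (K + i) + δ * ∑ j ∈ Finset.range i, γ (K + j)
        ≤ V K + (S (K + i) - S K) := by
      intro i
      induction i with
      | zero => simp
      | succ i ih =>
        rw [Finset.sum_range_succ, mul_add, ← add_assoc K i 1]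
        have h3 := hstep (K + i)
        have h4 := mul_le_mul_of_nonneg_left (ha _ (hcon (K + i) (by omega))) (hγ (K + i)).le
        linarith
    refine hγs ((summable_nat_add_iff K).1 ?_)
    refine summable_of_sum_range_le (c := (V K + η / 2) / δ) (fun i => (hγ _).le) fun i => ?_
    rw [le_div_iff₀ hδ]
    have h5 := hbound i
    have h6 := (hK K le_rfl).1
    have h7 := (hK (K + i) (by omega)).1
    rw [abs_lt] at h6 h7
    have h8 := hV (K + i)
    have h9 : ∑ j ∈ Finset.range i, γ (j + K) = ∑ j ∈ Finset.range i, γ (K + j) :=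
      Finset.sum_congr rfl fun j _ => by rw [add_comm]
    rw [h9]
    linarith
  -- Here `j` is the last time `V` was below `r`. One uncontrolled step from there costs at most `η
  -- / 2`, later steps descend up to the telescoping `S`, and `S k - S j` costs the other `η / 2`.
  have hinv : ∀ k, k₀ ≤ k → ∃ j, K ≤ j ∧ V k - S k ≤ r + η / 2 - S j := by
    intro k hk
    induction k, hk using Nat.le_induction with
    | base => exact ⟨k₀, hk₀, by linarith⟩
    | succ k hk ih =>
      have h3 := hstep k
      rcases le_or_gt r (V k) with hr | hr
      · obtain ⟨j, hj, hj'⟩ := ih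
        have h4 := mul_pos (hγ k) (hδ.trans_le (ha k hr))
        exact ⟨j, hj, by linarith⟩
      · refine ⟨k, hk₀.trans hk, ?_⟩
        have h4 := mul_le_mul_of_nonneg_left (hM k) (hγ k).le
        have h5 := (hK k (hk₀.trans hk)).2
        linarith
  filter_upwards [eventually_ge_atTop k₀] with k hk
  obtain ⟨j, hj, hj'⟩ := hinv k hk
  have h6 := (hK j hj).1
  have h7 := (hK k (hk₀.trans hk)).1
  rw [abs_lt] at h6 h7
  linarith

/-! ### Order bounds and measurability for the empirical estimator -/

section Empirical

variable {α : ℝ} {N : ℕ}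

/-- As `α ≤ 1`, the excess carries weight at least `1 / N`. This lower bound is what makes the
infimum defining `empCVaR` a genuine one. -/
lemma mean_le_objective (hα0 : 0 < α) (hα1 : α ≤ 1) (hN : 0 < N) (z : Fin N → ℝ) (η : ℝ) :
    (N : ℝ)⁻¹ * ∑ j, z j ≤ η + ((N : ℝ) * α)⁻¹ * ∑ j, max (z j - η) 0 := by
  have hN' : (0 : ℝ) < N := by exact_mod_cast hN
  have h1 : ∑ j, (z j - η) ≤ ∑ j, max (z j - η) 0 := Finset.sum_le_sum fun j _ => le_max_left _ _
  have h0 : 0 ≤ ∑ j, max (z j - η) 0 := Finset.sum_nonneg fun j _ => le_max_right _ _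
  have h2 : (N : ℝ)⁻¹ ≤ ((N : ℝ) * α)⁻¹ := by
    apply inv_anti₀ (by positivity)
    nlinarith
  have h3 : (N : ℝ)⁻¹ * ∑ j, (z j - η) = (N : ℝ)⁻¹ * ∑ j, z j - η := by
    rw [Finset.sum_sub_distrib]
    simp only [Finset.sum_const, Finset.card_univ, Fintype.card_fin, nsmul_eq_mul]
    field_simp
  have h4 := mul_le_mul_of_nonneg_left h1 (inv_pos.2 hN').le
  have h5 := mul_le_mul_of_nonneg_right h2 h0
  linarith

lemma bddBelow_empirical_objective (hα0 : 0 < α) (hα1 : α ≤ 1) (hN : 0 < N) (z : Fin N → ℝ) :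
    BddBelow (Set.range fun η : ℝ => η + ((N : ℝ) * α)⁻¹ * ∑ j, max (z j - η) 0) :=
  ⟨_, by rintro _ ⟨η, rfl⟩; exact mean_le_objective hα0 hα1 hN z η⟩

lemma mean_le_empCVaR (hα0 : 0 < α) (hα1 : α ≤ 1) (hN : 0 < N) (z : Fin N → ℝ) :
    (N : ℝ)⁻¹ * ∑ j, z j ≤ empCVaR α z :=
  le_ciInf fun η => mean_le_objective hα0 hα1 hN z η

lemma empCVaR_le_of_forall_le (hα0 : 0 < α) (hα1 : α ≤ 1) (hN : 0 < N) {z : Fin N → ℝ} {t : ℝ}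
    (hz : ∀ j, z j ≤ t) : empCVaR α z ≤ t := by
  refine (ciInf_le (bddBelow_empirical_objective hα0 hα1 hN z) t).trans_eq ?_
  have : ∑ j, max (z j - t) 0 = 0 :=
    Finset.sum_eq_zero fun j _ => max_eq_right (sub_nonpos.2 (hz j))
  rw [this, mul_zero, add_zero]

lemma lt_empCVaR_of_forall_lt (hα0 : 0 < α) (hα1 : α ≤ 1) (hN : 0 < N) {z : Fin N → ℝ} {t : ℝ}
    (hz : ∀ j, t < z j) : t < empCVaR α z := by
  refine lt_of_lt_of_le ?_ (mean_le_empCVaR hα0 hα1 hN z)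
  have hN' : (0 : ℝ) < N := by exact_mod_cast hN
  rw [lt_inv_mul_iff₀ hN']
  have : NeZero N := ⟨hN.ne'⟩
  calc (N : ℝ) * t = ∑ _j : Fin N, t := by simp
    _ < ∑ j, z j := Finset.sum_lt_sum_of_nonempty Finset.univ_nonempty fun j _ => hz j

lemma empCVaR_lt_of_forall_lt (hα0 : 0 < α) (hα1 : α ≤ 1) (hN : 0 < N) {z : Fin N → ℝ} {t : ℝ}
    (hz : ∀ j, z j < t) : empCVaR α z < t := by
  have : NeZero N := ⟨hN.ne'⟩
  refine (empCVaR_le_of_forall_le hα0 hα1 hN (t := Finset.univ.sup' Finset.univ_nonempty z)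
    fun j => Finset.le_sup' z (Finset.mem_univ j)).trans_lt ?_
  simpa [Finset.sup'_lt_iff] using hz

/-- The infimum is over uncountably many `η`, but its strict sublevel sets are unions of open sets.
-/
lemma measurable_empCVaR (hα0 : 0 < α) (hα1 : α ≤ 1) (hN : 0 < N) :
    Measurable fun z : Fin N → ℝ => empCVaR α z := by
  refine measurable_of_Iio fun t => IsOpen.measurableSet ?_
  have : (fun z : Fin N → ℝ => empCVaR α z) ⁻¹' Set.Iio t
      = ⋃ η : ℝ, {z | η + ((N : ℝ) * α)⁻¹ * ∑ j, max (z j - η) 0 < t} := by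
    ext z
    simp only [Set.mem_preimage, Set.mem_Iio, Set.mem_iUnion]
    exact ciInf_lt_iff (bddBelow_empirical_objective hα0 hα1 hN z)
  rw [this]
  exact isOpen_iUnion fun η => isOpen_lt (by fun_prop) continuous_const

end Empirical

/-! ### Uniform consistency of the estimator -/

section Sampling

variable {X : Type*} [MeasurableSpace X] {P : Measure X} [IsProbabilityMeasure P] {α : ℝ}

lemma measure_eq_zero_of_pi_const {N : ℕ} {s : Set X}
    (h : Measure.pi (fun _ : Fin N => P) (Set.univ.pi fun _ => s) = 0) : P s = 0 := by
  rw [Measure.pi_pi, Finset.prod_const] at h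
  exact eq_zero_of_pow_eq_zero h

/-- An almost surely bounded estimation error forces the sampled variable to be almost surely
bounded. -/
lemma ae_abs_sub_le_of_ae_abs_empCVaR_sub_le (hα0 : 0 < α) (hα1 : α ≤ 1) {N : ℕ} (hN : 0 < N)
    {Z : X → ℝ} {f B : ℝ}
    (h : ∀ᵐ x ∂Measure.pi (fun _ : Fin N => P), |empCVaR α (fun j => Z (x j)) - f| ≤ B) :
    ∀ᵐ y ∂P, |Z y - f| ≤ B := by
  -- If `Z > f + B` had probability `p > 0`, all `N` samples would exceed `f + B` with probability
  -- `p ^ N > 0`, and so would the estimator.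
  have h1 : P {y | f + B < Z y} = 0 := by
    refine measure_eq_zero_of_pi_const (N := N) (measure_mono_null ?_ (ae_iff.1 h))
    intro x hx
    have : f + B < empCVaR α (fun j => Z (x j)) :=
      lt_empCVaR_of_forall_lt hα0 hα1 hN fun j => hx j trivial
    change ¬ _
    intro hle
    linarith [(abs_le.1 hle).2]
  have h2 : P {y | Z y < f - B} = 0 := by
    refine measure_eq_zero_of_pi_const (N := N) (measure_mono_null ?_ (ae_iff.1 h))
    intro x hx
    have : empCVaR α (fun j => Z (x j)) < f - B :=
      empCVaR_lt_of_forall_lt hα0 hα1 hN fun j => hx j trivial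
    change ¬ _
    intro hle
    linarith [(abs_le.1 hle).1]
  have h1' : ∀ᵐ y ∂P, ¬ f + B < Z y := by simpa only [ae_iff, not_not] using h1
  have h2' : ∀ᵐ y ∂P, ¬ Z y < f - B := by simpa only [ae_iff, not_not] using h2
  filter_upwards [h1', h2'] with y hy1 hy2
  rw [abs_le]
  constructor <;> linarith

lemma expectation_le_objective (hα0 : 0 < α) (hα1 : α ≤ 1) {Z : X → ℝ} (hZ : Integrable Z P)
    (η : ℝ) : ∫ x, Z x ∂P ≤ η + α⁻¹ * ∫ x, max (Z x - η) 0 ∂P := by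
  have hi : Integrable (fun x => Z x - η) P := hZ.sub (integrable_const η)
  have h1 : ∫ x, (Z x - η) ∂P ≤ ∫ x, max (Z x - η) 0 ∂P :=
    integral_mono hi hi.pos_part fun x => le_max_left _ _
  have h0 : 0 ≤ ∫ x, max (Z x - η) 0 ∂P := integral_nonneg fun x => le_max_right _ _
  rw [integral_sub hZ (integrable_const η)] at h1
  simp only [integral_const, probReal_univ, smul_eq_mul, one_mul] at h1
  have h2 : 1 ≤ α⁻¹ := (one_le_inv₀ hα0).2 hα1
  nlinarith

/-- Deviation of the empirical mean of the excess over `η` from its expectation. -/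
noncomputable def excessDev (P : Measure X) (Z : X → ℝ) {N : ℕ} (x : Fin N → X) (η : ℝ) : ℝ :=
  (N : ℝ)⁻¹ * ∑ j, max (Z (x j) - η) 0 - ∫ y, max (Z y - η) 0 ∂P

/-- Infima of uniformly close functions are close; the two objectives differ by `α⁻¹ * excessDev`.
-/
lemma abs_empCVaR_sub_CVaR_le (hα0 : 0 < α) (hα1 : α ≤ 1) {N : ℕ} (hN : 0 < N) {Z : X → ℝ}
    (hZ : Integrable Z P) (x : Fin N → X) {r : ℝ} (hr : ∀ η, |excessDev P Z x η| ≤ r) :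
    |empCVaR α (fun j => Z (x j)) - CVaR P α Z| ≤ α⁻¹ * r := by
  have hb1 := bddBelow_empirical_objective hα0 hα1 hN fun j => Z (x j)
  have hb2 : BddBelow (Set.range fun η : ℝ => η + α⁻¹ * ∫ x, max (Z x - η) 0 ∂P) :=
    ⟨_, by rintro _ ⟨η, rfl⟩; exact expectation_le_objective hα0 hα1 hZ η⟩
  have hkey : ∀ η : ℝ, |(η + ((N : ℝ) * α)⁻¹ * ∑ j, max (Z (x j) - η) 0)
      - (η + α⁻¹ * ∫ x, max (Z x - η) 0 ∂P)| ≤ α⁻¹ * r := by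
    intro η
    have e : (η + ((N : ℝ) * α)⁻¹ * ∑ j, max (Z (x j) - η) 0)
      - (η + α⁻¹ * ∫ x, max (Z x - η) 0 ∂P) = α⁻¹ * excessDev P Z x η := by
      rw [excessDev, mul_inv]; ring
    rw [e, abs_mul, abs_of_pos (inv_pos.2 hα0)]
    exact mul_le_mul_of_nonneg_left (hr η) (inv_pos.2 hα0).le
  rw [abs_le]
  constructor
  · have : CVaR P α Z - α⁻¹ * r ≤ empCVaR α (fun j => Z (x j)) := le_ciInf fun η => by
      have h1 : CVaR P α Z ≤ _ := ciInf_le hb2 η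
      have h2 := (abs_le.1 (hkey η)).1
      linarith
    linarith
  · have : empCVaR α (fun j => Z (x j)) - α⁻¹ * r ≤ CVaR P α Z := le_ciInf fun η => by
      have h1 : empCVaR α (fun j => Z (x j)) ≤ _ := ciInf_le hb1 η
      have h2 := (abs_le.1 (hkey η)).2
      linarith
    linarith

lemma integrable_of_ae_abs_sub_le {Z : X → ℝ} (hZ : Measurable Z) {a B : ℝ}
    (hB : ∀ᵐ y ∂P, |Z y - a| ≤ B) : Integrable Z P := by
  refine Integrable.of_bound hZ.aestronglyMeasurable (B + |a|) ?_
  filter_upwards [hB] with y hy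
  rw [Real.norm_eq_abs]
  calc |Z y| = |(Z y - a) + a| := by rw [sub_add_cancel]
    _ ≤ _ := (abs_add_le _ _).trans (by linarith)

lemma abs_max_sub_max_le (u η η' : ℝ) : |max (u - η) 0 - max (u - η') 0| ≤ |η - η'| := by
  refine (abs_max_sub_max_le_abs _ _ _).trans_eq ?_
  rw [sub_sub_sub_cancel_left, abs_sub_comm]

lemma integrable_excess {Z : X → ℝ} (hZ : Integrable Z P) (η : ℝ) :
    Integrable (fun y => max (Z y - η) 0) P :=
  (hZ.sub (integrable_const η)).pos_part

lemma abs_excessDev_sub_le {Z : X → ℝ} (hZ : Integrable Z P) {N : ℕ} (hN : 0 < N)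
    (x : Fin N → X) (η η' : ℝ) :
    |excessDev P Z x η - excessDev P Z x η'| ≤ 2 * |η - η'| := by
  have hN' : (0 : ℝ) < N := by exact_mod_cast hN
  have h1 : |(N : ℝ)⁻¹ * ∑ j, max (Z (x j) - η) 0 - (N : ℝ)⁻¹ * ∑ j, max (Z (x j) - η') 0|
      ≤ |η - η'| := by
    rw [← mul_sub, ← Finset.sum_sub_distrib, abs_mul, abs_of_pos (inv_pos.2 hN'),
      inv_mul_le_iff₀ hN']
    refine (Finset.abs_sum_le_sum_abs _ _).trans ?_
    refine (Finset.sum_le_sum fun j _ => abs_max_sub_max_le _ η η').trans_eq ?_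
    simp
  have h2 : |∫ y, max (Z y - η) 0 ∂P - ∫ y, max (Z y - η') 0 ∂P| ≤ |η - η'| := by
    rw [← integral_sub (integrable_excess hZ η) (integrable_excess hZ η')]
    have := norm_integral_le_of_norm_le_const (μ := P)
      (f := fun y => max (Z y - η) 0 - max (Z y - η') 0)
      (Eventually.of_forall fun y => abs_max_sub_max_le (Z y) η η')
    simpa using this
  rw [excessDev, excessDev, sub_sub_sub_comm]
  refine (abs_sub _ _).trans ?_
  linarith

/-- For a variable with values in `[lo, hi]`, the deviation of the excess depends only on the
threshold truncated to `[lo, hi]`. -/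
lemma excessDev_eq_truncated {Z : X → ℝ} (hZ : Integrable Z P) {N : ℕ} (hN : 0 < N) {lo hi : ℝ}
    (hlo : ∀ᵐ y ∂P, lo ≤ Z y) (hhi : ∀ᵐ y ∂P, Z y ≤ hi) (hle : lo ≤ hi) {x : Fin N → X}
    (hxlo : ∀ j, lo ≤ Z (x j)) (hxhi : ∀ j, Z (x j) ≤ hi) (η : ℝ) :
    excessDev P Z x η = excessDev P Z x (max lo (min η hi)) := by
  have hN' : (N : ℝ) ≠ 0 := by exact_mod_cast hN.ne'
  -- Truncating the threshold shifts the excess by a constant independent of `u`, which cancels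
  -- between sample mean and expectation.
  have key : ∀ u, lo ≤ u → u ≤ hi →
      max (u - η) 0 = max (u - max lo (min η hi)) 0 + max (lo - η) 0 := by
    intro u h1 h2
    rcases le_total η lo with h | h
    · rw [min_eq_left (h.trans hle), max_eq_left h, max_eq_left (by linarith),
        max_eq_left (by linarith), max_eq_left (by linarith)]
      ring
    · rw [max_eq_right (sub_nonpos.2 h), add_zero]
      rcases le_total η hi with h' | h'
      · rw [min_eq_left h', max_eq_right h]
      · rw [min_eq_right h', max_eq_right hle, max_eq_right (by linarith),
          max_eq_right (by linarith)]
  have h1 : ∑ j, max (Z (x j) - η) 0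
      = ∑ j, max (Z (x j) - max lo (min η hi)) 0 + N * max (lo - η) 0 := by
    rw [Finset.sum_congr rfl fun j _ => key _ (hxlo j) (hxhi j), Finset.sum_add_distrib]
    simp
  have h2 : ∫ y, max (Z y - η) 0 ∂P
      = ∫ y, max (Z y - max lo (min η hi)) 0 ∂P + max (lo - η) 0 := by
    have : (fun y => max (Z y - η) 0)
        =ᵐ[P] fun y => max (Z y - max lo (min η hi)) 0 + max (lo - η) 0 := by
      filter_upwards [hlo, hhi] with y hy1 hy2 using key _ hy1 hy2
    rw [integral_congr_ae this, integral_add (integrable_excess hZ _) (integrable_const _)]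
    simp
  rw [excessDev, excessDev, h1, h2]
  field_simp
  ring

/-- The excess lies in `[0, 2 * B]`, so its variance is at most `4 * B ^ 2`; independence divides it
by `N`. -/
lemma integral_sq_excessDev_le {Z : X → ℝ} (hZ : Measurable Z) {N : ℕ} (hN : 0 < N) {a B : ℝ}
    (hB : ∀ᵐ y ∂P, |Z y - a| ≤ B) {η : ℝ} (hη : |η - a| ≤ B) :
    Integrable (fun x => excessDev P Z x η ^ 2) (Measure.pi fun _ : Fin N => P) ∧
    ∫ x, excessDev P Z x η ^ 2 ∂(Measure.pi fun _ : Fin N => P) ≤ 4 * B ^ 2 / N := by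
  have hN' : (0 : ℝ) < N := by exact_mod_cast hN
  have hB0 : 0 ≤ B := (abs_nonneg _).trans hη
  let Y : X → ℝ := fun y => max (Z y - η) 0
  have hYm : Measurable Y := by fun_prop
  have hYb : ∀ᵐ y ∂P, Y y ∈ Set.Icc 0 (2 * B) := by
    filter_upwards [hB] with y hy
    rw [abs_le] at hy hη
    exact ⟨le_max_right _ _, max_le (by linarith) (by linarith)⟩
  have hY2 : MemLp Y 2 P := memLp_of_bounded hYb hYm.aestronglyMeasurable 2
  have hvarY : Var[Y; P] ≤ 4 * B ^ 2 := by
    have h1 := variance_le_sub_mul_sub hYb hYm.aemeasurable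
    have h2 : 0 ≤ ∫ y, Y y ∂P := integral_nonneg fun y => le_max_right _ _
    have h3 : ∫ y, Y y ∂P ≤ 2 * B := by
      have := integral_mono_ae (hY2.integrable one_le_two) (integrable_const (2 * B))
        (hYb.mono fun y hy => hy.2)
      simpa using this
    nlinarith
  have hY2' : ∀ j : Fin N, MemLp (fun x : Fin N → X => Y (x j)) 2 (Measure.pi fun _ => P) :=
    fun j => hY2.comp_measurePreserving (measurePreserving_eval (fun _ : Fin N => P) j)
  have hvar := variance_sum_pi (μ := fun _ : Fin N => P) (X := fun _ => Y) fun _ => hY2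
  rw [Finset.sum_const, Finset.card_univ, Fintype.card_fin, nsmul_eq_mul] at hvar
  have hS2 : MemLp (∑ j : Fin N, fun x : Fin N → X => Y (x j)) 2 (Measure.pi fun _ => P) :=
    memLp_finsetSum' _ fun j _ => hY2' j
  have hmean : ∫ x, (∑ j : Fin N, fun x : Fin N → X => Y (x j)) x
      ∂(Measure.pi fun _ : Fin N => P) = N * ∫ y, Y y ∂P := by
    simp only [Finset.sum_apply]
    rw [integral_finsetSum _ fun j _ => (hY2' j).integrable one_le_two]
    have : ∀ j : Fin N, ∫ x, Y (x j) ∂(Measure.pi fun _ : Fin N => P) = ∫ y, Y y ∂P :=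
      fun j => integral_comp_eval (μ := fun _ : Fin N => P) hYm.aestronglyMeasurable
    simp [this]
  have hdev : ∀ x : Fin N → X, excessDev P Z x η ^ 2 = ((N : ℝ) ^ 2)⁻¹ *
      ((∑ j : Fin N, fun x : Fin N → X => Y (x j)) x - N * ∫ y, Y y ∂P) ^ 2 := by
    intro x
    simp only [excessDev, Finset.sum_apply, Y]
    field_simp
  simp only [hdev]
  constructor
  · exact ((hS2.sub (memLp_const _)).integrable_sq).const_mul _
  · rw [integral_const_mul]
    have h1 := variance_eq_integral hS2.aestronglyMeasurable.aemeasurable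
    rw [hmean] at h1
    rw [← h1, hvar, inv_mul_le_iff₀ (by positivity)]
    calc N * Var[Y; P] ≤ N * (4 * B ^ 2) := by gcongr
      _ = _ := by field_simp

/-- Uniform consistency in mean of the empirical conditional value-at-risk over all variables
with a given essential bound. -/
lemma exists_sampleSize_bias_le (hα0 : 0 < α) (hα1 : α ≤ 1) {B κ : ℝ} (hB0 : 0 ≤ B)
    (hκ : 0 < κ) :
    ∃ N₀ : ℕ, 0 < N₀ ∧ ∀ N, N₀ ≤ N → ∀ (P : Measure X) [IsProbabilityMeasure P] (Z : X → ℝ)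
      (a : ℝ), Measurable Z → (∀ᵐ y ∂P, |Z y - a| ≤ B) →
      ∫ x, |empCVaR α (fun j => Z (x j)) - CVaR P α Z| ∂(Measure.pi fun _ : Fin N => P) ≤ κ := by
  -- The tolerance `κ` is split in three: mesh `δ` of the net of thresholds, cutoff `θ` in `|u| ≤ θ
  -- + u ^ 2 / θ`, and variance.
  obtain ⟨δ, hδ, hδκ⟩ : ∃ δ : ℝ, 0 < δ ∧ α⁻¹ * (2 * δ) ≤ κ / 3 := by
    refine ⟨α * κ / 6, by positivity, le_of_eq ?_⟩
    field_simp
    norm_num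
  obtain ⟨T, hT, hTfin, hTcov⟩ :=
    (isCompact_Icc (a := -B) (b := B)).finite_cover_balls hδ
  obtain ⟨θ, hθ, hθκ⟩ : ∃ θ : ℝ, 0 < θ ∧ α⁻¹ * (hTfin.toFinset.card * θ) ≤ κ / 3 := by
    refine ⟨α * κ / (3 * (hTfin.toFinset.card + 1)), by positivity, ?_⟩
    rw [show α⁻¹ * (hTfin.toFinset.card * (α * κ / (3 * ((hTfin.toFinset.card : ℝ) + 1))))
      = κ / 3 * (hTfin.toFinset.card / ((hTfin.toFinset.card : ℝ) + 1)) by field_simp]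
    refine mul_le_of_le_one_right (by positivity) ?_
    rw [div_le_one (by positivity)]
    linarith
  obtain ⟨N₀, hN₀⟩ := exists_nat_gt (α⁻¹ * (hTfin.toFinset.card * (4 * B ^ 2 / θ)) / (κ / 3))
  refine ⟨N₀ + 1, by omega, fun N hN P _ Z a hZ hZB => ?_⟩
  have hNpos : 0 < N := by omega
  have hN' : (0 : ℝ) < N := by exact_mod_cast hNpos
  have hNκ : α⁻¹ * (hTfin.toFinset.card * (4 * B ^ 2 / N / θ)) ≤ κ / 3 := by
    have h1 : (N₀ : ℝ) ≤ N := by exact_mod_cast (by omega : N₀ ≤ N)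
    have h2 := hN₀.trans_le h1
    rw [div_lt_iff₀ (by positivity)] at h2
    rw [show α⁻¹ * (hTfin.toFinset.card * (4 * B ^ 2 / N / θ))
      = α⁻¹ * (hTfin.toFinset.card * (4 * B ^ 2 / θ)) / N by field_simp, div_le_iff₀ hN']
    linarith
  have hZi := integrable_of_ae_abs_sub_le hZ hZB
  let Q := Measure.pi fun _ : Fin N => P
  -- The sum over the net dominates the supremum over all `η`: truncation confines `η` to an
  -- interval and `excessDev` is 2-Lipschitz in `η`.
  have hpt : ∀ᵐ x ∂Q, |empCVaR α (fun j => Z (x j)) - CVaR P α Z|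
      ≤ α⁻¹ * (∑ t ∈ hTfin.toFinset, (θ + excessDev P Z x (a + t) ^ 2 / θ) + 2 * δ) := by
    have hx : ∀ᵐ x ∂Q, ∀ j : Fin N, |Z (x j) - a| ≤ B := by
      rw [ae_all_iff]
      intro j
      exact (Measure.quasiMeasurePreserving_eval (fun _ : Fin N => P) j).ae hZB
    filter_upwards [hx] with x hx
    refine abs_empCVaR_sub_CVaR_le hα0 hα1 hNpos hZi x fun η => ?_
    have htr := excessDev_eq_truncated hZi hNpos (lo := a - B) (hi := a + B)
      (hZB.mono fun y hy => by linarith [(abs_le.1 hy).1])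
      (hZB.mono fun y hy => by linarith [(abs_le.1 hy).2]) (by linarith) (x := x)
      (fun j => by linarith [(abs_le.1 (hx j)).1]) (fun j => by linarith [(abs_le.1 (hx j)).2]) η
    set η' := max (a - B) (min η (a + B))
    have hη' : η' - a ∈ Set.Icc (-B) B := by
      have h1 : a - B ≤ η' := le_max_left _ _
      have h2 : η' ≤ a + B := max_le (by linarith) (min_le_right _ _)
      constructor <;> linarith
    obtain ⟨t, htT, ht⟩ := Set.mem_iUnion₂.1 (hTcov hη')
    rw [Metric.mem_ball, Real.dist_eq] at ht
    have h3 := abs_excessDev_sub_le hZi hNpos x η' (a + t)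
    have h4 : |η' - (a + t)| < δ := by rwa [← sub_sub]
    have h5 : |excessDev P Z x (a + t)| ≤ θ + excessDev P Z x (a + t) ^ 2 / θ := by
      rw [← sub_le_iff_le_add', le_div_iff₀ hθ, ← sq_abs]
      nlinarith [sq_nonneg (|excessDev P Z x (a + t)| - θ), abs_nonneg (excessDev P Z x (a + t))]
    have h6 : θ + excessDev P Z x (a + t) ^ 2 / θ
        ≤ ∑ t ∈ hTfin.toFinset, (θ + excessDev P Z x (a + t) ^ 2 / θ) :=
      Finset.single_le_sum (f := fun t => θ + excessDev P Z x (a + t) ^ 2 / θ)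
        (fun t _ => by positivity) (hTfin.mem_toFinset.2 htT)
    rw [htr]
    have h7 := abs_sub_abs_le_abs_sub (excessDev P Z x η') (excessDev P Z x (a + t))
    linarith
  have hsq : ∀ t ∈ hTfin.toFinset, _ := fun t ht =>
    integral_sq_excessDev_le hZ hNpos hZB (η := a + t) (by
      rw [add_sub_cancel_left, abs_le]
      exact hT (hTfin.mem_toFinset.1 ht))
  have hint : ∀ t ∈ hTfin.toFinset, Integrable (fun x => θ + excessDev P Z x (a + t) ^ 2 / θ) Q :=
    fun t ht => (integrable_const θ).add ((hsq t ht).1.div_const θ)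
  have hsum := (integrable_finsetSum _ hint)
  calc ∫ x, |empCVaR α (fun j => Z (x j)) - CVaR P α Z| ∂Q
      ≤ ∫ x, α⁻¹ * (∑ t ∈ hTfin.toFinset, (θ + excessDev P Z x (a + t) ^ 2 / θ) + 2 * δ) ∂Q :=
        integral_mono_of_nonneg (Eventually.of_forall fun x => abs_nonneg _)
          ((hsum.add (integrable_const _)).const_mul _) hpt
    _ = α⁻¹ * (∑ t ∈ hTfin.toFinset, (θ + (∫ x, excessDev P Z x (a + t) ^ 2 ∂Q) / θ)
          + 2 * δ) := by
        rw [integral_const_mul, integral_add hsum (integrable_const _),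
          integral_finsetSum _ hint]
        congr 2
        · refine Finset.sum_congr rfl fun t ht => ?_
          rw [integral_add (integrable_const θ) ((hsq t ht).1.div_const θ), integral_div]
          simp [Q]
        · simp
    _ ≤ α⁻¹ * (∑ t ∈ hTfin.toFinset, (θ + 4 * B ^ 2 / N / θ) + 2 * δ) := by
        gcongr with t ht
        exact (hsq t ht).2
    _ = α⁻¹ * (hTfin.toFinset.card * θ) + α⁻¹ * (hTfin.toFinset.card * (4 * B ^ 2 / N / θ))
          + α⁻¹ * (2 * δ) := by
        rw [Finset.sum_const, nsmul_eq_mul]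
        ring
    _ ≤ κ := by linarith

end Sampling

/-! ### Martingale convergence of the weighted noise -/

/-- Weighted sums of bounded martingale differences with square-summable weights converge almost
surely. -/
lemma ae_exists_tendsto_sum_mul {Ω : Type*} {mΩ : MeasurableSpace Ω} {μ : Measure Ω}
    [IsProbabilityMeasure μ] (ℱ : Filtration ℕ mΩ) {X : ℕ → Ω → ℝ} {γ : ℕ → ℝ} {R : ℝ}
    (hX : ∀ k, StronglyMeasurable[ℱ (k + 1)] (X k)) (hb : ∀ k, ∀ᵐ ω ∂μ, |X k ω| ≤ R)
    (h0 : ∀ k s, MeasurableSet[ℱ k] s → ∫ ω in s, X k ω ∂μ = 0)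
    (hγ : Summable fun k => γ k ^ 2) :
    ∀ᵐ ω ∂μ, ∃ L, Tendsto (fun k => ∑ i ∈ Finset.range k, γ i * X i ω) atTop (𝓝 L) := by
  have hXm : ∀ k, AEStronglyMeasurable (X k) μ := fun k =>
    ((hX k).mono (ℱ.le _)).aestronglyMeasurable
  have hXi : ∀ k, Integrable (X k) μ := fun k => Integrable.of_bound (hXm k) R (hb k)
  let M : ℕ → Ω → ℝ := fun k ω => ∑ i ∈ Finset.range k, γ i * X i ω
  have hMs : ∀ k ω, M (k + 1) ω = M k ω + γ k * X k ω := fun k ω => Finset.sum_range_succ _ _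
  have hMad : StronglyAdapted ℱ M := by
    intro k
    induction k with
    | zero => simpa [M] using stronglyMeasurable_const
    | succ k ih =>
      have e : M (k + 1) = fun ω => M k ω + γ k * X k ω := funext (hMs k)
      rw [e]
      exact (ih.mono (ℱ.mono k.le_succ)).add ((hX k).const_mul (γ k))
  have hMm : ∀ k, AEStronglyMeasurable (M k) μ := fun k =>
    ((hMad k).mono (ℱ.le _)).aestronglyMeasurable
  have hMb : ∀ k, ∃ T, ∀ᵐ ω ∂μ, |M k ω| ≤ T := by
    intro k
    refine ⟨∑ i ∈ Finset.range k, |γ i| * R, ?_⟩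
    filter_upwards [ae_all_iff.2 hb] with ω hω
    refine (Finset.abs_sum_le_sum_abs _ _).trans (Finset.sum_le_sum fun i _ => ?_)
    rw [abs_mul]
    exact mul_le_mul_of_nonneg_left (hω i) (abs_nonneg _)
  have hMi : ∀ k, Integrable (M k) μ := fun k => by
    obtain ⟨T, hT⟩ := hMb k
    exact Integrable.of_bound (hMm k) T hT
  have hM2i : ∀ k, Integrable (fun ω => M k ω ^ 2) μ := fun k => by
    obtain ⟨T, hT⟩ := hMb k
    refine Integrable.of_bound ((hMm k).pow 2) (T ^ 2) ?_
    filter_upwards [hT] with ω hω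
    rw [Real.norm_eq_abs, abs_pow]
    gcongr
  have hMXi : ∀ k, Integrable (M k * X k) μ := fun k => by
    obtain ⟨T, hT⟩ := hMb k
    exact (hXi k).bdd_mul (hMm k) hT
  have hcond : ∀ k, μ[X k | ℱ k] =ᵐ[μ] 0 := by
    intro k
    symm
    refine ae_eq_condExp_of_forall_setIntegral_eq (ℱ.le k) (hXi k)
      (fun s _ _ => integrableOn_zero) (fun s hs _ => ?_) aestronglyMeasurable_zero
    simp [h0 k s hs]
  have hmart : Martingale M ℱ μ := by
    refine martingale_of_condExp_sub_eq_zero_nat hMad hMi fun k => ?_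
    have e : M (k + 1) - M k = γ k • X k := by
      ext ω
      simp [hMs]
    rw [e]
    refine (condExp_smul (γ k) (X k) (ℱ k)).trans ?_
    filter_upwards [hcond k] with ω hω
    simp [hω]
  -- Increments are orthogonal to the past, so second moments add up to at most `R ^ 2 * ∑ γ ^ 2`.
  have horth : ∀ k, ∫ ω, M k ω * X k ω ∂μ = 0 := by
    intro k
    have h1 := condExp_mul_of_stronglyMeasurable_left (hMad k) (hMXi k) (hXi k)
    have h2 := integral_condExp (μ := μ) (f := M k * X k) (ℱ.le k)
    rw [integral_congr_ae h1] at h2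
    have h3 : (M k * μ[X k | ℱ k]) =ᵐ[μ] 0 := by
      filter_upwards [hcond k] with ω hω
      simp [hω]
    rw [integral_congr_ae h3] at h2
    simpa using h2.symm
  have hM2 : ∀ k, ∫ ω, M k ω ^ 2 ∂μ ≤ ∑ i ∈ Finset.range k, γ i ^ 2 * R ^ 2 := by
    intro k
    induction k with
    | zero => simp [M]
    | succ k ih =>
      have hX2i : Integrable (fun ω => X k ω ^ 2) μ := by
        refine Integrable.of_bound ((hXm k).pow 2) (R ^ 2) ?_
        filter_upwards [hb k] with ω hω
        rw [Real.norm_eq_abs, abs_pow]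
        gcongr
      have hX2 : ∫ ω, X k ω ^ 2 ∂μ ≤ R ^ 2 := by
        have := integral_mono_ae hX2i (integrable_const (R ^ 2)) (by
          filter_upwards [hb k] with ω hω
          rw [← sq_abs]
          gcongr)
        simpa using this
      have e : ∀ ω, M (k + 1) ω ^ 2
          = (M k ω ^ 2 + 2 * γ k * (M k ω * X k ω)) + γ k ^ 2 * X k ω ^ 2 := by
        intro ω
        rw [hMs]
        ring
      simp only [e]
      have hMX' : Integrable (fun ω => 2 * γ k * (M k ω * X k ω)) μ := (hMXi k).const_mul _
      have hsum : Integrable (fun ω => M k ω ^ 2 + 2 * γ k * (M k ω * X k ω)) μ :=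
        (hM2i k).add hMX'
      rw [integral_add hsum (hX2i.const_mul _), integral_add (hM2i k) hMX',
        integral_const_mul, integral_const_mul, horth, Finset.sum_range_succ]
      have := mul_le_mul_of_nonneg_left hX2 (sq_nonneg (γ k))
      linarith
  refine hmart.submartingale.exists_ae_tendsto_of_bdd
    (R := Real.toNNReal (1 + (∑' i, γ i ^ 2) * R ^ 2)) fun k => ?_
  rw [eLpNorm_one_eq_lintegral_enorm, ← ofReal_integral_norm_eq_lintegral_enorm (hMi k)]
  refine ENNReal.ofReal_le_ofReal ?_
  calc ∫ ω, ‖M k ω‖ ∂μ ≤ ∫ ω, (1 + M k ω ^ 2) ∂μ := by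
        refine integral_mono (hMi k).norm ((integrable_const 1).add (hM2i k)) fun ω => ?_
        simp only [Real.norm_eq_abs]
        rw [← sq_abs]
        nlinarith [sq_nonneg (|M k ω| - 1), abs_nonneg (M k ω)]
    _ = 1 + ∫ ω, M k ω ^ 2 ∂μ := by
        rw [integral_add (integrable_const 1) (hM2i k)]
        simp
    _ ≤ _ := by
        have h1 := hM2 k
        rw [← Finset.sum_mul] at h1
        have h2 := hγ.sum_le_tsum (Finset.range k) fun i _ => sq_nonneg (γ i)
        have h3 := mul_le_mul_of_nonneg_right h2 (sq_nonneg R)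
        linarith

/-! ### Freezing the past against an independent batch -/

section Freezing

variable {Ω β ζ : Type*} {m mΩ : MeasurableSpace Ω} [MeasurableSpace β] [MeasurableSpace ζ]
  {μ : Measure Ω} [IsProbabilityMeasure μ] {Y : Ω → β} {Z : Ω → ζ}

lemma map_prodMk_of_indep (hm : m ≤ mΩ) (hZ : Measurable Z)
    (hind : Indep m (MeasurableSpace.comap Z inferInstance) μ) (hY : Measurable[m] Y) :
    μ.map (fun ω => (Y ω, Z ω)) = (μ.map Y).prod (μ.map Z) := by
  refine (indepFun_iff_map_prod_eq_prod_map_map (hY.mono hm le_rfl).aemeasurable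
    hZ.aemeasurable).1 ?_
  exact indep_of_indep_of_le_left hind hY.comap_le

/-- A function of a past variable and of an independent one that is centred in the latter has
zero integral over every event of the past. -/
lemma setIntegral_eq_zero_of_indep (hm : m ≤ mΩ) (hZ : Measurable Z)
    (hind : Indep m (MeasurableSpace.comap Z inferInstance) μ) (hY : Measurable[m] Y)
    {φ : β × ζ → ℝ} (hφ : Measurable φ) (hint : Integrable (fun ω => φ (Y ω, Z ω)) μ)
    (h0 : ∀ᵐ y ∂μ.map Y, ∫ z, φ (y, z) ∂μ.map Z = 0) {s : Set Ω} (hs : MeasurableSet[m] s) :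
    ∫ ω in s, φ (Y ω, Z ω) ∂μ = 0 := by
  have hYm : Measurable Y := hY.mono hm le_rfl
  -- Adjoining the indicator of `s` to the past variable turns the integral over `s` into one
  -- against a product law.
  let W : Ω → β × ℝ := fun ω => (Y ω, s.indicator (fun _ => (1 : ℝ)) ω)
  have hW : Measurable[m] W := hY.prodMk (measurable_const.indicator hs)
  have hWm : Measurable W := hW.mono hm le_rfl
  let g : (β × ℝ) × ζ → ℝ := fun p => p.1.2 * φ (p.1.1, p.2)
  have hg : Measurable g := by fun_prop
  have hpair : Measurable fun ω => (W ω, Z ω) := hWm.prodMk hZ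
  have e : (s.indicator fun ω => φ (Y ω, Z ω)) = fun ω => g (W ω, Z ω) := by
    ext ω
    by_cases h : ω ∈ s <;> simp [g, W, h]
  have hmap := map_prodMk_of_indep hm hZ hind hW
  have hgi : Integrable g ((μ.map W).prod (μ.map Z)) := by
    rw [← hmap, integrable_map_measure hg.aestronglyMeasurable hpair.aemeasurable]
    have h1 := hint.indicator (hm _ hs)
    rw [e] at h1
    exact h1
  have : IsProbabilityMeasure (μ.map W) := Measure.isProbabilityMeasure_map hWm.aemeasurable
  have : IsProbabilityMeasure (μ.map Z) := Measure.isProbabilityMeasure_map hZ.aemeasurable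
  rw [← integral_indicator (hm _ hs), e,
    ← integral_map (f := g) hpair.aemeasurable hg.aestronglyMeasurable, hmap,
    integral_prod _ hgi]
  have hfst : (μ.map W).map Prod.fst = μ.map Y := by
    rw [Measure.map_map measurable_fst hWm]
    rfl
  rw [← hfst] at h0
  refine integral_eq_zero_of_ae ?_
  filter_upwards [ae_of_ae_map measurable_fst.aemeasurable h0] with w hw
  simp only [g, integral_const_mul, hw, mul_zero, Pi.zero_apply]

end Freezing

/-! ### Pathwise analysis of the recursion -/

/-- Pathwise convergence of the projected recursion when the weighted centred errors are
summable. -/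
lemma limsup_norm_sub_le_of_recursion {n l : ℕ} {A : Matrix (Fin l) (Fin n) ℝ} {b : E l}
    {h g β : ℕ → E n} {hstar : E n} {γ bias : ℕ → ℝ} {ε δ Mg Mβ D L : ℝ} (hγ : IsStepSize γ)
    (hrec : ∀ k, h (k + 1) = h k - γ k • kerProj A (g k + β k))
    (hA : ∀ k, h k ∈ affSet A b) (hstarA : hstar ∈ affSet A b)
    (hg : ∀ k, ‖g k‖ ≤ Mg) (hβ : ∀ k, ‖β k‖ ≤ Mβ) (hD : ∀ k, ‖h k - hstar‖ ≤ D)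
    (hε : 0 < ε) (hδ : 0 < δ)
    (hdesc : ∀ k, ε ≤ ‖h k - hstar‖ → δ ≤ inner ℝ (h k - hstar) (g k))
    (hbias : ∀ k, |bias k| ≤ δ / 2)
    (hnoise : Tendsto (fun k => ∑ i ∈ Finset.range k,
      γ i * (inner ℝ (h i - hstar) (β i) - bias i)) atTop (𝓝 L)) :
    limsup (fun k => ‖h k - hstar‖) atTop ≤ ε := by
  obtain ⟨hγpos, hγs, hγ2⟩ := hγ
  have hγ0 : Tendsto γ atTop (𝓝 0) := by
    have h1 := hγ2.tendsto_atTop_zero.sqrt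
    simpa [Real.sqrt_sq (hγpos _).le] using h1
  let V : ℕ → ℝ := fun k => ‖h k - hstar‖ ^ 2
  -- Away from `hstar` this is at least `2 * (δ - δ / 2) = δ`. The centred noise and the quadratic
  -- term go into `S`, which converges.
  let a : ℕ → ℝ := fun k => 2 * (inner ℝ (h k - hstar) (g k) + bias k)
  let S : ℕ → ℝ := fun k =>
    -2 * (∑ i ∈ Finset.range k, γ i * (inner ℝ (h i - hstar) (β i) - bias i))
      + (∑ i ∈ Finset.range k, γ i ^ 2) * (Mg + Mβ) ^ 2
  have hS : Tendsto S atTop (𝓝 (-2 * L + (∑' i, γ i ^ 2) * (Mg + Mβ) ^ 2)) :=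
    (hnoise.const_mul _).add (hγ2.hasSum.tendsto_sum_nat.mul_const _)
  have hstep : ∀ k, V (k + 1) ≤ V k - γ k * a k + (S (k + 1) - S k) := by
    intro k
    have e1 : h (k + 1) - hstar = (h k - hstar) - γ k • kerProj A (g k + β k) := by
      rw [hrec]; abel
    have e2 : V (k + 1) = V k - 2 * γ k * inner ℝ (h k - hstar) (g k + β k)
        + γ k ^ 2 * ‖kerProj A (g k + β k)‖ ^ 2 := by
      simp only [V]
      rw [e1, norm_sub_sq_real, inner_smul_right, inner_kerProj (hA k) hstarA, norm_smul,
        mul_pow, Real.norm_eq_abs, sq_abs]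
      ring
    have h3 : ‖kerProj A (g k + β k)‖ ^ 2 ≤ (Mg + Mβ) ^ 2 := by
      have := (norm_kerProj_le (A := A) (g k + β k)).trans (norm_add_le _ _)
      exact pow_le_pow_left₀ (norm_nonneg _) (by linarith [hg k, hβ k]) 2
    have h4 := mul_le_mul_of_nonneg_left h3 (sq_nonneg (γ k))
    have e3 : S (k + 1) - S k = -2 * (γ k * (inner ℝ (h k - hstar) (β k) - bias k))
        + γ k ^ 2 * (Mg + Mβ) ^ 2 := by
      simp only [S, Finset.sum_range_succ]
      ring
    rw [e2, e3, inner_add_right]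
    simp only [a]
    linarith
  have hM : ∀ k, -(2 * (D * Mg) + δ) ≤ a k := by
    intro k
    have h1 := (abs_le.1 (abs_real_inner_le_norm (h k - hstar) (g k))).1
    have h2 : ‖h k - hstar‖ * ‖g k‖ ≤ D * Mg :=
      mul_le_mul (hD k) (hg k) (norm_nonneg _) ((norm_nonneg _).trans (hD k))
    have h3 := (abs_le.1 (hbias k)).1
    simp only [a]
    linarith
  have ha : ∀ k, ε ^ 2 ≤ V k → δ ≤ a k := by
    intro k hk
    have h1 := hdesc k ((pow_le_pow_iff_left₀ hε.le (norm_nonneg _) two_ne_zero).1 hk)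
    have h3 := (abs_le.1 (hbias k)).1
    simp only [a]
    linarith
  refine le_of_forall_gt_imp_ge_of_dense fun t ht => ?_
  refine limsup_le_of_le (isCoboundedUnder_le_of_le atTop fun k => norm_nonneg _) ?_
  have hη : 0 < t ^ 2 - ε ^ 2 := by nlinarith
  filter_upwards [eventually_le_of_descent (fun k => sq_nonneg _) hγpos hγ0 hγs hS hstep hM hδ ha
    hη] with k hk
  have h5 : ‖h k - hstar‖ ^ 2 ≤ t ^ 2 := by
    have : ‖h k - hstar‖ ^ 2 ≤ ε ^ 2 + (t ^ 2 - ε ^ 2) := hk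
    linarith
  exact (pow_le_pow_iff_left₀ (norm_nonneg _) (hε.trans ht).le two_ne_zero).1 h5

/-! ### Error bias, sample filtration and adaptedness of the iterates -/

section Algorithm

variable {n m l s : ℕ} {P : Measure (E m)} {α : ℝ} {C : E n → E m → E n}

lemma measurable_estError (hα0 : 0 < α) (hα1 : α ≤ 1) (hC : Measurable (Function.uncurry C))
    (hF : Measurable (cvarMap P α C)) {N : ℕ} (hN : 0 < N) :
    Measurable fun p : E n × (Fin N → E m) => estError P α C p.2 p.1 := by
  refine Measurable.sub ?_ (hF.comp measurable_fst)
  refine (WithLp.measurable_toLp 2 (Fin n → ℝ)).comp (measurable_pi_lambda _ fun i => ?_)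
  refine (measurable_empCVaR hα0 hα1 hN).comp (measurable_pi_lambda _ fun j => ?_)
  have h1 : Measurable fun p : E n × (Fin N → E m) => C p.1 (p.2 j) :=
    hC.comp (measurable_fst.prodMk ((measurable_pi_apply j).comp measurable_snd))
  exact (EuclideanSpace.proj (𝕜 := ℝ) i).continuous.measurable.comp h1

/-- The mean of the error tested against a fixed direction is small, uniformly over all points at
which the error is almost surely bounded. -/
lemma exists_sampleSize_integral_inner_estError_le [IsProbabilityMeasure P] (hα0 : 0 < α)
    (hα1 : α ≤ 1) (hC : Measurable (Function.uncurry C)) {B κ : ℝ} (hB0 : 0 ≤ B) (hκ : 0 < κ) :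
    ∃ N₀ : ℕ, 0 < N₀ ∧ ∀ N, N₀ ≤ N → ∀ h : E n,
      (∀ᵐ z ∂(Measure.pi fun _ : Fin N => P), ‖estError P α C z h‖ ≤ B) → ∀ v : E n,
      |∫ z, inner ℝ v (estError P α C z h) ∂(Measure.pi fun _ : Fin N => P)|
        ≤ ‖v‖ * (n * κ) := by
  obtain ⟨N₀, hN₀, hbias⟩ := exists_sampleSize_bias_le (X := E m) hα0 hα1 hB0 hκ
  refine ⟨N₀, hN₀, fun N hN h hb v => ?_⟩
  have hNpos : 0 < N := hN₀.trans_le hN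
  have hcomp : ∀ i, ∀ᵐ z ∂(Measure.pi fun _ : Fin N => P),
      |empCVaR α (fun j => C h (z j) i) - CVaR P α fun ξ => C h ξ i| ≤ B := by
    intro i
    filter_upwards [hb] with z hz
    exact (PiLp.norm_apply_le (estError P α C z h) i).trans hz
  have hmeasC : ∀ i, Measurable fun ξ => C h ξ i := fun i =>
    (EuclideanSpace.proj (𝕜 := ℝ) i).continuous.measurable.comp
      (hC.comp (measurable_const.prodMk measurable_id))
  have hcompi : ∀ i, Integrable (fun z : Fin N → E m =>
      |empCVaR α (fun j => C h (z j) i) - CVaR P α fun ξ => C h ξ i|)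
      (Measure.pi fun _ : Fin N => P) := by
    intro i
    refine Integrable.of_bound (C := B) (Measurable.aestronglyMeasurable ?_) ?_
    · have h1 : Measurable fun z : Fin N → E m => empCVaR α (fun j => C h (z j) i) :=
        (measurable_empCVaR hα0 hα1 hNpos).comp
          (measurable_pi_lambda _ fun j => (hmeasC i).comp (measurable_pi_apply j))
      exact (h1.sub_const _).abs
    · filter_upwards [hcomp i] with z hz
      rwa [Real.norm_eq_abs, abs_abs]
  -- The almost sure bound on the error bounds `C h ξ i` around `F_i(h)`, which is all the
  -- consistency result requires.
  have hcompb : ∀ i, _ := fun i => hbias N hN P (fun ξ => C h ξ i) _ (hmeasC i)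
    (ae_abs_sub_le_of_ae_abs_empCVaR_sub_le hα0 hα1 hNpos (hcomp i))
  have hpt : ∀ z : Fin N → E m, |inner ℝ v (estError P α C z h)|
      ≤ ‖v‖ * ∑ i, |empCVaR α (fun j => C h (z j) i) - CVaR P α fun ξ => C h ξ i| := by
    intro z
    rw [PiLp.inner_apply, Finset.mul_sum]
    refine (Finset.abs_sum_le_sum_abs _ _).trans (Finset.sum_le_sum fun i _ => ?_)
    refine (abs_real_inner_le_norm _ _).trans ?_
    exact mul_le_mul_of_nonneg_right (PiLp.norm_apply_le v i) (norm_nonneg _)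
  calc |∫ z, inner ℝ v (estError P α C z h) ∂(Measure.pi fun _ : Fin N => P)|
      ≤ ∫ z, |inner ℝ v (estError P α C z h)| ∂(Measure.pi fun _ : Fin N => P) :=
        abs_integral_le_integral_abs
    _ ≤ ∫ z, ‖v‖ * ∑ i, |empCVaR α (fun j => C h (z j) i) - CVaR P α fun ξ => C h ξ i|
          ∂(Measure.pi fun _ : Fin N => P) :=
        integral_mono_of_nonneg (Eventually.of_forall fun z => abs_nonneg _)
          ((integrable_finsetSum _ fun i _ => hcompi i).const_mul _) (Eventually.of_forall hpt)
    _ = ‖v‖ * ∑ i, ∫ z : Fin N → E m,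
          |empCVaR α (fun j => C h (z j) i) - CVaR P α fun ξ => C h ξ i|
          ∂(Measure.pi fun _ : Fin N => P) := by
        rw [integral_const_mul, integral_finsetSum _ fun i _ => hcompi i]
    _ ≤ ‖v‖ * (n * κ) := by
        gcongr
        refine (Finset.sum_le_sum fun i _ => hcompb i).trans_eq ?_
        simp

variable {Ω : Type*} {mΩ : MeasurableSpace Ω} {μ : Measure Ω} {N : ℕ → ℕ}
  {ξ : (k : ℕ) → Fin (N k) → Ω → E m}

lemma measurable_batch_iSup {T : Set ((k : ℕ) × Fin (N k))} {k : ℕ} (hT : ∀ j, ⟨k, j⟩ ∈ T) :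
    Measurable[⨆ p ∈ T, MeasurableSpace.comap (ξ p.1 p.2) inferInstance]
      fun ω j => ξ k j ω := by
  refine @measurable_pi_lambda _ _ _ (_) _ _ fun j => ?_
  have h1 := le_biSup (fun p : (k : ℕ) × Fin (N k) =>
    MeasurableSpace.comap (ξ p.1 p.2) inferInstance) (hT j)
  exact Measurable.mono (comap_measurable (ξ k j)) h1 le_rfl

/-- The filtration generated by the samples drawn before each iteration. -/
def sampleFiltration (hξ : ∀ k j, Measurable (ξ k j)) : Filtration ℕ mΩ where
  seq k := ⨆ p ∈ {p : (k : ℕ) × Fin (N k) | p.1 < k},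
    MeasurableSpace.comap (ξ p.1 p.2) inferInstance
  mono' := fun _ _ hij => biSup_mono fun _ hp => lt_of_lt_of_le hp hij
  le' := fun _ => iSup₂_le fun p _ => (hξ p.1 p.2).comap_le

lemma measurable_batch_sampleFiltration (hξ : ∀ k j, Measurable (ξ k j)) (k : ℕ) :
    Measurable[sampleFiltration hξ (k + 1)] fun ω j => ξ k j ω :=
  measurable_batch_iSup fun _ => Nat.lt_succ_self k

lemma indep_sampleFiltration_batch (hiid : IIDSamples μ P N ξ) (k : ℕ) :
    Indep (sampleFiltration hiid.1 k)
      (MeasurableSpace.comap (fun ω j => ξ k j ω) inferInstance) μ := by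
  have h1 := indep_iSup_of_disjoint
    (m := fun p : (k : ℕ) × Fin (N k) => MeasurableSpace.comap (ξ p.1 p.2) inferInstance)
    (fun p => (hiid.1 p.1 p.2).comap_le) hiid.2.2 (S := {p | p.1 < k}) (T := {p | p.1 = k})
    (Set.disjoint_left.2 fun p hp hp' => (ne_of_lt hp) hp')
  exact indep_of_indep_of_le_right h1 (measurable_batch_iSup fun _ => rfl).comap_le

lemma map_batch_eq_pi [IsProbabilityMeasure μ] (hiid : IIDSamples μ P N ξ) (k : ℕ) :
    μ.map (fun ω j => ξ k j ω) = Measure.pi fun _ : Fin (N k) => P := by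
  have h1 : iIndepFun (fun j : Fin (N k) => ξ k j) μ :=
    hiid.2.2.precomp (g := fun j : Fin (N k) => (⟨k, j⟩ : (k : ℕ) × Fin (N k)))
      fun _ _ h => eq_of_heq (Sigma.mk.inj h).2
  rw [(iIndepFun_iff_map_fun_eq_pi_map fun j => (hiid.1 k j).aemeasurable).1 h1]
  simp only [hiid.2.1]

variable {A : Matrix (Fin l) (Fin n) ℝ} {q : Fin s → E n → ℝ}

lemma measurable_subspaceIter (hα0 : 0 < α) (hα1 : α ≤ 1) (hC : Measurable (Function.uncurry C))
    (hF : Measurable (cvarMap P α C)) (hproj : Measurable (proj (ineqSet q)))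
    (hN : ∀ k, 0 < N k) (hξ : ∀ k j, Measurable (ξ k j)) (γ : ℕ → ℝ) (c : ℝ) (h0 : E n) (k : ℕ) :
    Measurable[sampleFiltration hξ k]
      fun ω => subspaceIter P α C A q γ c N (fun k j => ξ k j ω) h0 k := by
  induction k with
  | zero => exact measurable_const
  | succ k ih =>
    let G : E n × (Fin (N k) → E m) → E n := fun p => p.1 - γ k • kerProj A
      (cvarMap P α C p.1 + c • (p.1 - proj (ineqSet q) p.1) + estError P α C p.2 p.1)
    have hG : Measurable G := by
      have h1 := measurable_estError hα0 hα1 hC hF (hN k)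
      have h2 : Measurable fun p : E n × (Fin (N k) → E m) => cvarMap P α C p.1 :=
        hF.comp measurable_fst
      have h3 : Measurable fun p : E n × (Fin (N k) → E m) => proj (ineqSet q) p.1 :=
        hproj.comp measurable_fst
      exact measurable_fst.sub (((kerProj A).continuous.measurable.comp
        ((h2.add ((measurable_fst.sub h3).const_smul c)).add h1)).const_smul (γ k))
    exact hG.comp ((ih.mono ((sampleFiltration hξ).mono k.le_succ) le_rfl).prodMk
      (measurable_batch_sampleFiltration hξ k))

lemma subspaceIter_mem_affSet {b : E l} {h0 : E n} (hh0 : h0 ∈ affSet A b) (γ : ℕ → ℝ) (c : ℝ)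
    (x : (k : ℕ) → Fin (N k) → E m) (k : ℕ) :
    subspaceIter P α C A q γ c N x h0 k ∈ affSet A b := by
  induction k with
  | zero => exact hh0
  | succ k ih => exact sub_smul_kerProj_mem_affSet ih _ _

end Algorithm

/-- Functions of an adapted process and of the fresh batch of samples, centred by their mean over
the batch, have convergent weighted sums, provided they are almost surely bounded. -/
lemma ae_exists_tendsto_sum_centred {m : ℕ} {P : Measure (E m)} [IsProbabilityMeasure P]
    {Ω : Type*} {mΩ : MeasurableSpace Ω} {μ : Measure Ω} [IsProbabilityMeasure μ] {N : ℕ → ℕ}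
    {ξ : (k : ℕ) → Fin (N k) → Ω → E m} (hiid : IIDSamples μ P N ξ) {β : Type*}
    [MeasurableSpace β] {Y : ℕ → Ω → β} (hY : ∀ k, Measurable[sampleFiltration hiid.1 k] (Y k))
    {ψ : (k : ℕ) → β × (Fin (N k) → E m) → ℝ} (hψ : ∀ k, Measurable (ψ k)) {R : ℝ}
    (hψb : ∀ k, ∀ᵐ ω ∂μ, |ψ k (Y k ω, fun j => ξ k j ω)| ≤ R)
    (hψb' : ∀ k, ∀ᵐ y ∂μ.map (Y k), ∀ᵐ z ∂(Measure.pi fun _ : Fin (N k) => P), |ψ k (y, z)| ≤ R)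
    {γ : ℕ → ℝ} (hγ : Summable fun k => γ k ^ 2) :
    ∀ᵐ ω ∂μ, ∃ L, Tendsto (fun k => ∑ i ∈ Finset.range k,
      γ i * (ψ i (Y i ω, fun j => ξ i j ω)
        - ∫ z, ψ i (Y i ω, z) ∂(Measure.pi fun _ : Fin (N i) => P))) atTop (𝓝 L) := by
  have hYm : ∀ k, Measurable (Y k) := fun k => (hY k).mono ((sampleFiltration hiid.1).le k) le_rfl
  have hZm : ∀ k, Measurable fun ω j => ξ k j ω := fun k =>
    measurable_pi_lambda _ fun j => hiid.1 k j
  let φ : (k : ℕ) → β × (Fin (N k) → E m) → ℝ := fun k p =>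
    ψ k p - ∫ z, ψ k (p.1, z) ∂(Measure.pi fun _ : Fin (N k) => P)
  have hφ : ∀ k, Measurable (φ k) := fun k =>
    (hψ k).sub (((hψ k).stronglyMeasurable.integral_prod_right'
      (ν := Measure.pi fun _ : Fin (N k) => P)).measurable.comp measurable_fst)
  have hφb : ∀ k, ∀ᵐ ω ∂μ, |φ k (Y k ω, fun j => ξ k j ω)| ≤ 2 * R := by
    intro k
    filter_upwards [hψb k, ae_of_ae_map (hYm k).aemeasurable (hψb' k)] with ω h1 h2
    have h3 := norm_integral_le_of_norm_le_const (f := fun z => ψ k (Y k ω, z)) h2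
    simp only [probReal_univ, mul_one, Real.norm_eq_abs] at h3
    refine (abs_sub _ _).trans ?_
    linarith
  refine ae_exists_tendsto_sum_mul (sampleFiltration hiid.1)
    (X := fun k ω => φ k (Y k ω, fun j => ξ k j ω)) (R := 2 * R) (fun k => ?_) hφb
    (fun k t ht => ?_) hγ
  · exact ((hφ k).comp (((hY k).mono ((sampleFiltration hiid.1).mono k.le_succ) le_rfl).prodMk
      (measurable_batch_sampleFiltration hiid.1 k))).stronglyMeasurable
  · refine setIntegral_eq_zero_of_indep ((sampleFiltration hiid.1).le k) (hZm k)
      (indep_sampleFiltration_batch hiid k) (hY k) (hφ k) ?_ ?_ ht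
    · exact Integrable.of_bound ((hφ k).comp ((hYm k).prodMk (hZm k))).aestronglyMeasurable _
        (hφb k)
    · rw [map_batch_eq_pi hiid k]
      filter_upwards [hψb' k] with y hy
      have hi : Integrable (fun z => ψ k (y, z)) (Measure.pi fun _ : Fin (N k) => P) :=
        Integrable.of_bound ((hψ k).comp measurable_prodMk_left).aestronglyMeasurable R hy
      simp only [φ]
      rw [integral_sub hi (integrable_const _)]
      simp

end CVaRVI

/-! ### The convergence theorem -/

theorem proposition2 {n m l s : ℕ}
    -- the random cost, its law, the risk level
    (P : Measure (CVaRVI.E m)) [IsProbabilityMeasure P]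
    (α : ℝ) (hα0 : 0 < α) (hα1 : α ≤ 1)
    (C : CVaRVI.E n → CVaRVI.E m → CVaRVI.E n) (hC : Measurable (Function.uncurry C))
    (hFcont : Continuous (CVaRVI.cvarMap P α C))
    (hFmono : CVaRVI.StrictlyMonotone (CVaRVI.cvarMap P α C))
    -- the feasible set
    (A : Matrix (Fin l) (Fin n) ℝ) (b : CVaRVI.E l) (q : Fin s → CVaRVI.E n → ℝ)
    (hqconv : ∀ i, ConvexOn ℝ Set.univ (q i)) (hqdiff : ∀ i, ContDiff ℝ 1 (q i))
    (hcompact : IsCompact (CVaRVI.feasSet A b q))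
    -- the solution of the variational inequality
    (hstar : CVaRVI.E n)
    (hsol : hstar ∈ CVaRVI.SOL (CVaRVI.feasSet A b q) (CVaRVI.cvarMap P α C)) :
    -- the iterates stay in the affine set
    (∀ (γ : ℕ → ℝ) (c : ℝ) (N : ℕ → ℕ) (x : (k : ℕ) → Fin (N k) → CVaRVI.E m),
      ∀ h0 ∈ CVaRVI.affSet A b, ∀ k,
        CVaRVI.subspaceIter P α C A q γ c N x h0 k ∈ CVaRVI.affSet A b) ∧
    -- convergence to the `ε`-neighbourhood of the solution
    ∀ ε : ℝ, 0 < ε → ∀ Btraj : ℝ, ∃ cε : ℝ, 0 < cε ∧ ∀ Berr : ℝ, ∃ Nε : ℕ,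
      ∀ (γ : ℕ → ℝ) (c : ℝ) (N : ℕ → ℕ) (h0 : CVaRVI.E n)
        (Ω : Type*) [MeasurableSpace Ω] (μ : Measure Ω) [IsProbabilityMeasure μ]
        (ξ : (k : ℕ) → Fin (N k) → Ω → CVaRVI.E m),
        CVaRVI.IsStepSize γ → h0 ∈ CVaRVI.affSet A b → CVaRVI.IIDSamples μ P N ξ →
        cε ≤ c → (∀ k, Nε ≤ N k) →
        (∀ᵐ ω ∂μ, ∀ k,
          ‖CVaRVI.subspaceIter P α C A q γ c N (fun k j => ξ k j ω) h0 k‖ ≤ Btraj) →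
        (∀ᵐ ω ∂μ, ∀ k,
          ‖CVaRVI.estError P α C (fun j => ξ k j ω)
            (CVaRVI.subspaceIter P α C A q γ c N (fun k j => ξ k j ω) h0 k)‖ ≤ Berr) →
        ∀ᵐ ω ∂μ,
          limsup (fun k =>
            ‖CVaRVI.subspaceIter P α C A q γ c N (fun k j => ξ k j ω) h0 k - hstar‖) atTop ≤ ε := by
  have hqc : ∀ i, Continuous (q i) := fun i => (hqdiff i).continuous
  have hcl : IsClosed (CVaRVI.ineqSet q) := CVaRVI.isClosed_ineqSet hqc
  have hconv : Convex ℝ (CVaRVI.ineqSet q) := CVaRVI.convex_ineqSet hqconv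
  have hproj : Continuous (CVaRVI.proj (CVaRVI.ineqSet q)) :=
    CVaRVI.continuous_proj ⟨hstar, hsol.1.2⟩ hcl hconv
  refine ⟨fun γ c N x h0 hh0 k => CVaRVI.subspaceIter_mem_affSet hh0 γ c x k,
    fun ε hε Btraj => ?_⟩
  obtain ⟨cε, hcε, δ, hδ, hdesc⟩ :=
    CVaRVI.exists_penalty_inner_ge hFcont hFmono hcl hconv hsol hε Btraj
  refine ⟨cε, hcε, fun Berr => ?_⟩
  let D : ℝ := |Btraj| + ‖hstar‖
  have hD0 : 0 ≤ D := by positivity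
  -- Chosen so that `D * (n * κ) ≤ δ / 2`; the `+ 1` covers `D * n = 0`.
  have hκ : 0 < δ / (2 * (D * n + 1)) := by positivity
  obtain ⟨Nε, hNε, hbias⟩ := CVaRVI.exists_sampleSize_integral_inner_estError_le (P := P) hα0 hα1
    hC (abs_nonneg Berr) hκ
  refine ⟨Nε, fun γ c N h0 Ω _ μ _ ξ hγ hh0 hiid hc hN htraj herr => ?_⟩
  have hNpos : ∀ k, 0 < N k := fun k => hNε.trans_le (hN k)
  let h : ℕ → Ω → CVaRVI.E n := fun k ω =>
    CVaRVI.subspaceIter P α C A q γ c N (fun k j => ξ k j ω) h0 k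
  have hh : ∀ k, Measurable[CVaRVI.sampleFiltration hiid.1 k] (h k) := fun k =>
    CVaRVI.measurable_subspaceIter hα0 hα1 hC hFcont.measurable hproj.measurable hNpos hiid.1 γ c
      h0 k
  have hhm : ∀ k, Measurable (h k) := fun k =>
    (hh k).mono ((CVaRVI.sampleFiltration hiid.1).le k) le_rfl
  have hZm : ∀ k, Measurable fun ω j => ξ k j ω := fun k =>
    measurable_pi_lambda _ fun j => hiid.1 k j
  have herrm : ∀ k, Measurable fun p : CVaRVI.E n × (Fin (N k) → CVaRVI.E m) =>
      CVaRVI.estError P α C p.2 p.1 := fun k =>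
    CVaRVI.measurable_estError hα0 hα1 hC hFcont.measurable (hNpos k)
  -- The iterate and the fresh batch have a product joint law, so the almost sure bounds along the
  -- run hold, for almost every frozen iterate, for almost every batch.
  have hfrozen : ∀ k, ∀ᵐ y ∂μ.map (h k), ∀ᵐ z ∂(Measure.pi fun _ : Fin (N k) => P),
      ‖y‖ ≤ Btraj ∧ ‖CVaRVI.estError P α C z y‖ ≤ Berr := by
    intro k
    refine Measure.ae_ae_of_ae_prod (p := fun p : CVaRVI.E n × (Fin (N k) → CVaRVI.E m) =>
      ‖p.1‖ ≤ Btraj ∧ ‖CVaRVI.estError P α C p.2 p.1‖ ≤ Berr) ?_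
    rw [← CVaRVI.map_batch_eq_pi hiid k,
      ← CVaRVI.map_prodMk_of_indep ((CVaRVI.sampleFiltration hiid.1).le k) (hZm k)
        (CVaRVI.indep_sampleFiltration_batch hiid k) (hh k)]
    refine (ae_map_iff ((hhm k).prodMk (hZm k)).aemeasurable ?_).2 ?_
    · exact (measurableSet_le measurable_fst.norm measurable_const).inter
        (measurableSet_le (herrm k).norm measurable_const)
    · filter_upwards [htraj, herr] with ω h1 h2 using ⟨h1 k, h2 k⟩
  have hdist : ∀ y : CVaRVI.E n, ‖y‖ ≤ Btraj → ‖y - hstar‖ ≤ D := fun y hy =>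
    (norm_sub_le _ _).trans (add_le_add_left (hy.trans (le_abs_self _)) _)
  let ψ : (k : ℕ) → CVaRVI.E n × (Fin (N k) → CVaRVI.E m) → ℝ := fun k p =>
    inner ℝ (p.1 - hstar) (CVaRVI.estError P α C p.2 p.1)
  have hψ : ∀ k, Measurable (ψ k) := fun k => (measurable_fst.sub_const hstar).inner (herrm k)
  have hψle : ∀ k (y : CVaRVI.E n) (z : Fin (N k) → CVaRVI.E m), ‖y‖ ≤ Btraj →
      ‖CVaRVI.estError P α C z y‖ ≤ Berr → |ψ k (y, z)| ≤ D * Berr := fun k y z hy hz =>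
    (abs_real_inner_le_norm _ _).trans (mul_le_mul (hdist y hy) hz (norm_nonneg _) hD0)
  have hnoise := CVaRVI.ae_exists_tendsto_sum_centred hiid hh hψ (R := D * Berr)
    (fun k => by filter_upwards [htraj, herr] with ω h1 h2 using hψle k _ _ (h1 k) (h2 k))
    (fun k => by
      filter_upwards [hfrozen k] with y hy
      filter_upwards [hy] with z hz using hψle k _ _ hz.1 hz.2) hγ.2.2
  have hbiasle : ∀ᵐ ω ∂μ, ∀ k,
      |∫ z, ψ k (h k ω, z) ∂(Measure.pi fun _ : Fin (N k) => P)| ≤ δ / 2 := by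
    rw [ae_all_iff]
    intro k
    filter_upwards [htraj, ae_of_ae_map (hhm k).aemeasurable (hfrozen k)] with ω h1 h2
    refine (hbias (N k) (hN k) (h k ω) (h2.mono fun z hz => hz.2.trans (le_abs_self _))
      (h k ω - hstar)).trans ?_
    calc ‖h k ω - hstar‖ * (n * (δ / (2 * (D * n + 1))))
        ≤ D * (n * (δ / (2 * (D * n + 1)))) := by gcongr; exact hdist _ (h1 k)
      _ = δ / 2 * (D * n / (D * n + 1)) := by field_simp
      _ ≤ δ / 2 := mul_le_of_le_one_right (by positivity)
          ((div_le_one (by positivity)).2 (by linarith))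
  let g : CVaRVI.E n → CVaRVI.E n := fun y =>
    CVaRVI.cvarMap P α C y + c • (y - CVaRVI.proj (CVaRVI.ineqSet q) y)
  have hg : Continuous g := hFcont.add ((continuous_id.sub hproj).const_smul c)
  -- This bound depends on `c`, harmlessly: it enters only the pathwise argument, not the
  -- thresholds.
  obtain ⟨Mg, hMg⟩ := (isCompact_closedBall (0 : CVaRVI.E n) Btraj).exists_bound_of_continuousOn
    hg.continuousOn
  filter_upwards [htraj, herr, hbiasle, hnoise] with ω h1 h2 h3 ⟨L, hL⟩
  exact CVaRVI.limsup_norm_sub_le_of_recursion (h := fun k => h k ω) (g := fun k => g (h k ω))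
    hγ (fun k => rfl) (fun k => CVaRVI.subspaceIter_mem_affSet hh0 γ c _ k) hsol.1.1
    (fun k => hMg _ (by simpa using h1 k)) h2 (fun k => hdist _ (h1 k)) hε hδ
    (fun k hk => hdesc c hc _ (CVaRVI.subspaceIter_mem_affSet hh0 γ c _ k) (h1 k) hk) h3 hL
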